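/- All sets are finite. A polymatroid $(f,N)$ is a real function $f$ on the subsets of $N$ with $f(\emptyset)=0$, $f(A)\le f(B)$ whenever $A\subseteq B\subseteq N$, and $f(A\cap B)+f(A\cup B)\le f(A)+f(B)$ for all $A,B\subseteq N$. A 3-partition $\langle X,Y\mid D\rangle$ of $M$ is a partition $M=X\cup Y\cup D$ into three non-empty pairwise disjoint sets; it separates a family $\mathcal T$ of subsets of $M$ if no $T\in\mathcal T$ intersects both $X$ and $Y$. Write $g(X,Y\mid D)=g(X\cup D)+g(Y\cup D)-g(D)-g(X\cup Y\cup D)$. Given a surjective map $\varphi:M\to N$, a set $T\subseteq M$ is a transversal if $\varphi$ restricted to $T$ is a bijection between $T$ and $N$. Let $|N|=4$, let $\varphi:M\to N$ be surjective, and let $\mathcal T$ be a collection of transversals in $M$ such that every 3-partition $\langle X,Y\mid D\rangle$ of $M$ separating $\mathcal T$ satisfies $|D|\ge 3$. Then for every polymatroid $(f,N)$ there is a polymatroid $(g,M)$ with the following (GMAXE) properties: (i) for every $T\in\mathcal T$, the map $\varphi$ restricted to $T$ is an isomorphism between the restriction of $g$ to $T$ and $f$, that is, $g(A)=f(\varphi(A))$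 for all $A\subseteq T$; (ii) $g(X,Y\mid D)=0$ for every 3-partition $\langle X,Y\mid D\rangle$ of $M$ that separates $\mathcal T$. Consequently, such an instance yields no new inequality: if a linear inequality $\sum_{A\subseteq N}c_A f(A)\ge 0$ with real coefficients $c_A$ holds for every polymatroid $(f,N)$ for which there is a polymatroid $(g,M)$ with properties (i) and (ii), then it holds for every polymatroid $(f,N)$. -/

import Mathlib

/-- A polymatroid `(f, N)`: a normalized, monotone and submodular rank function on the subsets of
the finite base set `N` (hence non-negative). -/
structure IsPolymatroid {N : Type*} [DecidableEq N] (f : Finset N → ℝ) : Prop where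
  empty : f ∅ = 0
  mono : ∀ A B : Finset N, A ⊆ B → f A ≤ f B
  submodular : ∀ A B : Finset N, f (A ∩ B) + f (A ∪ B) ≤ f A + f B

/-- The conditional mutual information `f(X, Y | D) = f(XD) + f(YD) - f(D) - f(XYD)`. -/
def condMutualInfo {M : Type*} [DecidableEq M] (f : Finset M → ℝ) (X Y D : Finset M) : ℝ :=
  f (X ∪ D) + f (Y ∪ D) - f D - f (X ∪ Y ∪ D)

/-- `⟨X, Y | D⟩` is a 3-partition of the base set `M`: the three pieces are non-empty, pairwise
disjoint, and their union is `M`. -/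
structure IsThreePartition {M : Type*} [Fintype M] [DecidableEq M] (X Y D : Finset M) : Prop where
  nonempty_left : X.Nonempty
  nonempty_right : Y.Nonempty
  nonempty_last : D.Nonempty
  disjoint_left_right : Disjoint X Y
  disjoint_left_last : Disjoint X D
  disjoint_right_last : Disjoint Y D
  union_eq : X ∪ Y ∪ D = Finset.univ

/-- The 3-partition `⟨X, Y | D⟩` separates the family `𝓕` of subsets: no member of `𝓕` intersects
both `X` and `Y` (the piece `D` plays no further role). -/
def Separates {M : Type*} (X Y : Finset M) (𝓕 : Set (Finset M)) : Prop :=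
  ∀ F ∈ 𝓕, ¬ (¬ Disjoint F X ∧ ¬ Disjoint F Y)

/-- `T ⊆ M` is a transversal of `φ : M → N`: the restriction of `φ` to `T` is a bijection
between `T` and `N`. -/
def IsTransversal {M N : Type*} (φ : M → N) (T : Finset M) : Prop :=
  Set.BijOn φ (T : Set M) Set.univ

/-- The polymatroid `(g, M)` has the two properties of the Generalized Maximum Entropy Method
for the polymatroid `(f, N)`, the map `φ : M → N` and the family `𝓣` of transversals. -/
structure HasGMAXE {M N : Type*} [Fintype M] [DecidableEq M] [DecidableEq N]
    (φ : M → N) (𝓣 : Set (Finset M)) (f : Finset N → ℝ) (g : Finset M → ℝ) : Prop where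
  /-- `φ` restricted to `T` is an isomorphism between `g` restricted to `T` and `f`. -/
  iso : ∀ T ∈ 𝓣, ∀ A : Finset M, A ⊆ T → g A = f (A.image φ)
  /-- `g(X, Y | D) = 0` whenever the 3-partition `⟨X, Y | D⟩` of `M` separates `𝓣`. -/
  indep : ∀ X Y D : Finset M, IsThreePartition X Y D → Separates X Y 𝓣 →
    condMutualInfo g X Y D = 0

/-- The linear inequality `∑ A, c A * f A ≥ 0` holds for the function `f` on the subsets
of `N`. -/
def SatisfiesIneq {N : Type*} [Fintype N] (c f : Finset N → ℝ) : Prop :=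
  0 ≤ ∑ A : Finset N, c A * f A

/-- The linear inequality with coefficients `c` is a consequence of the GMAXE instance given by
`φ` and `𝓣`: it holds for every polymatroid on `N` for which there is a polymatroid on `M` with the
GMAXE properties. -/
def IsGMAXEConsequence {M N : Type*} [Fintype M] [DecidableEq M] [Fintype N] [DecidableEq N]
    (φ : M → N) (𝓣 : Set (Finset M)) (c : Finset N → ℝ) : Prop :=
  ∀ f : Finset N → ℝ, IsPolymatroid f →
    (∃ g : Finset M → ℝ, IsPolymatroid g ∧ HasGMAXE φ 𝓣 f g) → SatisfiesIneq c f

/-! Both GMAXE properties are linear in the pair (f, g), so the functions with an extension form a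
convex cone and it suffices to extend generators. Subtracting from f the modular function with
weights f(N) - f(N - a) leaves a tight part, which takes a single value on all sets with at least
three elements; for |N| = 4 it is described by eleven coordinates.

Two mechanisms extend generators. For the rank function of a vector configuration
(`vectorRank_mem_gmaxeCone`), take a configuration on M with the prescribed ranks inside every
transversal and with maximal total rank. If g(X, Y | D) were positive for a separating 3-partition,
the free amalgam of its restrictions to X ∪ D and Y ∪ D over D would have larger rank. This needs no
bound on |D|. For a flat generator (`pairFn_mem_gmaxeCone`), pull back the values at points and
pairs along φ and let g be constant on all sets with at least three elements; |D| ≥ 3 makes the four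
terms of g(X, Y | D) equal. The pullback needs a suitable value at pairs with the same image.

A certified double description computation places the cone of tight parts inside the cone generated
by `rays`, and each of these falls under one of the two mechanisms. The modular part is a
non-negative combination of ranks of configurations with one nonzero vector. -/

open scoped NNReal

/-- The cone of functions `f` on the subsets of `N` that have a GMAXE extension. -/
def gmaxeCone {M N : Type*} [Fintype M] [DecidableEq M] [DecidableEq N]
    (φ : M → N) (𝓣 : Set (Finset M)) : Submodule ℝ≥0 (Finset N → ℝ) where
  carrier := {f | ∃ g : Finset M → ℝ, IsPolymatroid g ∧ HasGMAXE φ 𝓣 f g}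
  zero_mem' := ⟨0, ⟨rfl, fun _ _ _ => le_rfl, fun _ _ => le_rfl⟩,
    ⟨fun _ _ _ _ => rfl, fun _ _ _ _ _ => by simp [condMutualInfo]⟩⟩
  add_mem' := by
    rintro f₁ f₂ ⟨g₁, p₁, h₁⟩ ⟨g₂, p₂, h₂⟩
    refine ⟨g₁ + g₂, ⟨by simp [p₁.empty, p₂.empty], fun A B h => ?_, fun A B => ?_⟩,
      ⟨fun T hT A hA => ?_, fun X Y D h s => ?_⟩⟩
    · exact add_le_add (p₁.mono A B h) (p₂.mono A B h)
    · have := p₁.submodular A B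
      have := p₂.submodular A B
      simp only [Pi.add_apply]
      linarith
    · simp [h₁.iso T hT A hA, h₂.iso T hT A hA]
    · have e₁ := h₁.indep X Y D h s
      have e₂ := h₂.indep X Y D h s
      simp only [condMutualInfo, Pi.add_apply] at *
      linarith
  smul_mem' := by
    rintro c f ⟨g, p, h⟩
    refine ⟨c • g, ⟨by simp [p.empty], fun A B h => ?_, fun A B => ?_⟩,
      ⟨fun T hT A hA => ?_, fun X Y D h' s => ?_⟩⟩
    · exact mul_le_mul_of_nonneg_left (p.mono A B h) c.2
    · have := mul_le_mul_of_nonneg_left (p.submodular A B) c.2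
      simp only [Pi.smul_apply, NNReal.smul_def, smul_eq_mul, mul_add] at *
      exact this
    · simp [h.iso T hT A hA]
    · have e := h.indep X Y D h' s
      simp only [condMutualInfo, Pi.smul_apply, NNReal.smul_def, smul_eq_mul] at *
      linear_combination (c : ℝ) * e

/-- Separation enters the amalgamation argument only in this form: a gluing along D that preserves
both sides leaves every transversal untouched. -/
theorem IsThreePartition.subset_or_subset {M : Type*} [Fintype M] [DecidableEq M]
    {X Y D : Finset M} (h : IsThreePartition X Y D) {𝓕 : Set (Finset M)} (hs : Separates X Y 𝓕)
    {T : Finset M} (hT : T ∈ 𝓕) : T ⊆ X ∪ D ∨ T ⊆ Y ∪ D := by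
  have hu : ∀ x, x ∈ X ∨ x ∈ Y ∨ x ∈ D := fun x => by
    have := Finset.mem_univ x
    rw [← h.union_eq] at this
    simp only [Finset.mem_union] at this
    tauto
  by_cases hX : Disjoint T X
  · right
    intro x hx
    have := Finset.disjoint_left.1 hX hx
    have := hu x
    simp only [Finset.mem_union]
    tauto
  · left
    intro x hx
    have hY : Disjoint T Y := by
      by_contra hY
      exact hs T hT ⟨hX, hY⟩
    have := Finset.disjoint_left.1 hY hx
    have := hu x
    simp only [Finset.mem_union]
    tauto

/-! ### Vector configurations and their amalgams -/

section VectorRank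

open Module Submodule

variable {K V M : Type*} [Field K] [AddCommGroup V] [Module K V]

/-- The rank of a set of indices of a vector configuration. -/
noncomputable def vectorRank (K : Type*) {V M : Type*} [Field K] [AddCommGroup V] [Module K V]
    (w : M → V) (A : Finset M) : ℕ :=
  finrank K (span K (w '' (A : Set M)))

instance finiteDimensional_span_image_finset (w : M → V) (A : Finset M) :
    FiniteDimensional K (span K (w '' (A : Set M))) :=
  FiniteDimensional.span_of_finite K (A.finite_toSet.image w)

theorem vectorRank_empty (w : M → V) : vectorRank K w ∅ = 0 := by
  simp [vectorRank]

theorem vectorRank_mono (w : M → V) {A B : Finset M} (h : A ⊆ B) :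
    vectorRank K w A ≤ vectorRank K w B :=
  Submodule.finrank_mono (span_mono (Set.image_mono (by exact_mod_cast h)))

theorem vectorRank_submodular [DecidableEq M] (w : M → V) (A B : Finset M) :
    vectorRank K w (A ∩ B) + vectorRank K w (A ∪ B) ≤ vectorRank K w A + vectorRank K w B := by
  have h := Submodule.finrank_sup_add_finrank_inf_eq
    (span K (w '' (A : Set M))) (span K (w '' (B : Set M)))
  rw [← span_union, ← Set.image_union, ← Finset.coe_union] at h
  have h' : vectorRank K w (A ∩ B) ≤
      finrank K ↥(span K (w '' (A : Set M)) ⊓ span K (w '' (B : Set M))) := by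
    refine Submodule.finrank_mono (le_inf (span_mono (Set.image_mono ?_))
      (span_mono (Set.image_mono ?_))) <;> simp
  simp only [vectorRank] at *
  omega

theorem vectorRank_le_card (w : M → V) (A : Finset M) : vectorRank K w A ≤ A.card := by
  classical
  have h := finrank_span_finset_le_card (R := K) (A.image w)
  rw [Set.finrank, Finset.coe_image] at h
  exact h.trans Finset.card_image_le

theorem isPolymatroid_vectorRank [DecidableEq M] (w : M → V) :
    IsPolymatroid (fun A => (vectorRank K w A : ℝ)) :=
  ⟨by simp [vectorRank_empty], fun _ _ h => by exact_mod_cast vectorRank_mono w h,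
    fun A B => by exact_mod_cast vectorRank_submodular w A B⟩

theorem vectorRank_image {N : Type*} [DecidableEq N] (v : N → V) (φ : M → N) (A : Finset M) :
    vectorRank K v (A.image φ) = vectorRank K (v ∘ φ) A := by
  rw [vectorRank, vectorRank, Finset.coe_image, Set.image_comp]

theorem vectorRank_eq_of_injective {V' : Type*} [AddCommGroup V'] [Module K V']
    {w : M → V} {w' : M → V'} (ι : V →ₗ[K] V') (hι : Function.Injective ι) {A : Finset M}
    (h : ∀ x ∈ A, w' x = ι (w x)) : vectorRank K w' A = vectorRank K w A := by
  have : w' '' (A : Set M) = ι '' (w '' (A : Set M)) := by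
    rw [← Set.image_comp]
    exact Set.image_congr h
  rw [vectorRank, this, span_image]
  exact (LinearEquiv.finrank_eq (Submodule.equivMapOfInjective ι hι _)).symm

/-- The free amalgam of a vector configuration with itself over the span of the vectors
indexed by `D`. -/
theorem exists_amalgam [DecidableEq M] (w : M → V) {X Y D : Finset M} (hXY : Disjoint X Y) (hYD : Disjoint Y D) :
    ∃ (W : Submodule K (V × V)) (w' : M → (V × V) ⧸ W),
      (∀ A, A ⊆ X ∪ D → vectorRank K w' A = vectorRank K w A) ∧
      (∀ A, A ⊆ Y ∪ D → vectorRank K w' A = vectorRank K w A) ∧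
      vectorRank K w (X ∪ D) + vectorRank K w (Y ∪ D) ≤
        vectorRank K w' (X ∪ Y ∪ D) + vectorRank K w D := by
  classical
  let S := span K (w '' (D : Set M))
  -- Dividing by the vectors (u, -u) with u in S identifies the two copies of S in V × V and nothing
  -- else.
  let W : Submodule K (V × V) := S.map (LinearMap.prod LinearMap.id (-LinearMap.id))
  have hW : ∀ u v : V, (u, v) ∈ W ↔ u ∈ S ∧ v = -u := by
    intro u v
    simp only [W, Submodule.mem_map, LinearMap.prod_apply, Function.prod, LinearMap.id_apply,
      LinearMap.neg_apply, Prod.mk.injEq]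
    constructor
    · rintro ⟨y, hy, rfl, rfl⟩
      exact ⟨hy, rfl⟩
    · rintro ⟨hu, rfl⟩
      exact ⟨u, hu, rfl, rfl⟩
  let ι₁ : V →ₗ[K] (V × V) ⧸ W := W.mkQ ∘ₗ LinearMap.inl K V V
  let ι₂ : V →ₗ[K] (V × V) ⧸ W := W.mkQ ∘ₗ LinearMap.inr K V V
  have e : ∀ u v, ι₁ u = ι₂ v ↔ u ∈ S ∧ u = v := by
    intro u v
    simp only [ι₁, ι₂, LinearMap.comp_apply, Submodule.mkQ_apply, LinearMap.inl_apply,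
      LinearMap.inr_apply, Submodule.Quotient.eq, Prod.mk_sub_mk, sub_zero, zero_sub, hW, neg_inj]
    tauto
  have hι₁ : Function.Injective ι₁ := by
    rw [injective_iff_map_eq_zero]
    intro u hu
    exact ((e u 0).1 (by rw [hu, map_zero])).2
  have hι₂ : Function.Injective ι₂ := by
    rw [injective_iff_map_eq_zero]
    intro u hu
    exact ((e 0 u).1 (by rw [hu, map_zero])).2.symm
  let w' : M → (V × V) ⧸ W := fun x => if x ∈ Y then ι₂ (w x) else ι₁ (w x)
  have h₁ : ∀ x ∈ X ∪ D, w' x = ι₁ (w x) := by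
    intro x hx
    refine if_neg fun hy => ?_
    rcases Finset.mem_union.1 hx with h | h
    · exact Finset.disjoint_left.1 hXY h hy
    · exact Finset.disjoint_left.1 hYD hy h
  have h₂ : ∀ x ∈ Y ∪ D, w' x = ι₂ (w x) := by
    intro x hx
    by_cases hy : x ∈ Y
    · exact if_pos hy
    · have hD : x ∈ D := (Finset.mem_union.1 hx).resolve_left hy
      rw [h₁ x (Finset.mem_union_right _ hD)]
      exact (e _ _).2 ⟨subset_span ⟨x, hD, rfl⟩, rfl⟩
  have r₁ : ∀ A, A ⊆ X ∪ D → vectorRank K w' A = vectorRank K w A := fun A hA =>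
    vectorRank_eq_of_injective ι₁ hι₁ fun x hx => h₁ x (hA hx)
  have r₂ : ∀ A, A ⊆ Y ∪ D → vectorRank K w' A = vectorRank K w A := fun A hA =>
    vectorRank_eq_of_injective ι₂ hι₂ fun x hx => h₂ x (hA hx)
  refine ⟨W, w', r₁, r₂, ?_⟩
  rw [← r₁ _ subset_rfl, ← r₂ _ subset_rfl, ← r₁ D Finset.subset_union_right]
  have h := Submodule.finrank_sup_add_finrank_inf_eq
    (span K (w' '' (↑(X ∪ D) : Set M))) (span K (w' '' (↑(Y ∪ D) : Set M)))
  rw [← span_union, ← Set.image_union, ← Finset.coe_union] at h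
  have hu : (X ∪ D) ∪ (Y ∪ D) = X ∪ Y ∪ D := by
    ext
    simp only [Finset.mem_union]
    tauto
  -- The two copies of V meet exactly in the image of S, so the intersection is no larger than the
  -- span of D; the dimension formula then gives the lower bound on the rank of the union.
  have hi : finrank K ↥(span K (w' '' (↑(X ∪ D) : Set M)) ⊓ span K (w' '' (↑(Y ∪ D) : Set M))) ≤
      vectorRank K w' D := by
    refine Submodule.finrank_mono ?_
    have i₁ : w' '' (↑(X ∪ D) : Set M) = ι₁ '' (w '' (↑(X ∪ D) : Set M)) := by
      rw [← Set.image_comp]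
      exact Set.image_congr h₁
    have i₂ : w' '' (↑(Y ∪ D) : Set M) = ι₂ '' (w '' (↑(Y ∪ D) : Set M)) := by
      rw [← Set.image_comp]
      exact Set.image_congr h₂
    have i₃ : w' '' (D : Set M) = ι₁ '' (w '' (D : Set M)) := by
      rw [← Set.image_comp]
      exact Set.image_congr fun x hx => h₁ x (Finset.mem_union_right _ hx)
    rw [i₁, i₂, i₃, span_image, span_image, span_image]
    rintro _ ⟨⟨u, -, rfl⟩, ⟨v, -, hv⟩⟩
    exact ⟨u, ((e u v).1 hv.symm).1, rfl⟩
  rw [hu] at h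
  simp only [vectorRank] at *
  omega

end VectorRank

/-- Rank functions of vector configurations have GMAXE extensions for every family of
transversals. -/
theorem vectorRank_mem_gmaxeCone {K V : Type} [Field K] [AddCommGroup V] [Module K V]
    {M N : Type*} [Fintype M] [DecidableEq M] [DecidableEq N] (φ : M → N)
    (𝓣 : Set (Finset M)) (v : N → V) :
    (fun A => (vectorRank K v A : ℝ)) ∈ gmaxeCone φ 𝓣 := by
  classical
  -- The ambient space U varies because amalgamation enlarges it. The total rank is bounded by |M|,
  -- so a maximal one exists; it plays the role of maximum entropy.
  let P : ℕ → Prop := fun n => ∃ (U : Type) (_ : AddCommGroup U) (_ : Module K U) (w : M → U),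
    (∀ T ∈ 𝓣, ∀ A ⊆ T, vectorRank K w A = vectorRank K v (A.image φ)) ∧
      vectorRank K w Finset.univ = n
  have h₀ : P (vectorRank K (v ∘ φ) Finset.univ) :=
    ⟨V, _, _, v ∘ φ, fun _ _ A _ => (vectorRank_image v φ A).symm, rfl⟩
  have hb : ∀ n, P n → n ≤ Fintype.card M := by
    rintro n ⟨U, _, _, w, -, rfl⟩
    exact vectorRank_le_card w _
  obtain ⟨U, _, _, w, hw, hn⟩ := Nat.findGreatest_spec (hb _ h₀) h₀
  refine ⟨fun A => (vectorRank K w A : ℝ), isPolymatroid_vectorRank w,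
    fun T hT A hA => by exact_mod_cast hw T hT A hA, fun X Y D h hs => ?_⟩
  obtain ⟨W, w', r₁, r₂, hr⟩ := exists_amalgam (K := K) w h.disjoint_left_right
    h.disjoint_right_last
  have hP : P (vectorRank K w' Finset.univ) := by
    refine ⟨_, _, _, w', fun T hT A hA => ?_, rfl⟩
    rw [← hw T hT A hA]
    rcases h.subset_or_subset hs hT with h' | h'
    · exact r₁ A (hA.trans h')
    · exact r₂ A (hA.trans h')
  -- Maximality bounds the rank of the amalgam by that of w, while submodularity gives the opposite
  -- inequality; together they force equality.
  have hle := Nat.le_findGreatest (hb _ hP) hP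
  rw [← hn] at hle
  have hsub := vectorRank_submodular (K := K) w (X ∪ D) (Y ∪ D)
  have hi : (X ∪ D) ∩ (Y ∪ D) = D := by
    rw [← Finset.inter_union_distrib_right, Finset.disjoint_iff_inter_eq_empty.1
      h.disjoint_left_right, Finset.empty_union]
  have hu : (X ∪ D) ∪ (Y ∪ D) = X ∪ Y ∪ D := by
    ext
    simp only [Finset.mem_union]
    tauto
  rw [hi, hu] at hsub
  rw [h.union_eq] at hr hsub
  have heq : vectorRank K w (X ∪ D) + vectorRank K w (Y ∪ D) =
      vectorRank K w D + vectorRank K w Finset.univ := by omega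
  have heq' : (vectorRank K w (X ∪ D) : ℝ) + vectorRank K w (Y ∪ D) =
      vectorRank K w D + vectorRank K w Finset.univ := by exact_mod_cast heq
  rw [condMutualInfo, h.union_eq]
  linarith

/-! ### Set functions constant on sets with at least three elements -/

/-- A set function that vanishes on the empty set is a polymatroid if it is monotone and
submodular for the addition of single elements. -/
theorem isPolymatroid_of_insert {M : Type*} [DecidableEq M] (g : Finset M → ℝ) (h₀ : g ∅ = 0)
    (hm : ∀ A, ∀ i ∉ A, g A ≤ g (insert i A))
    (hs : ∀ A, ∀ i ∉ A, ∀ j ∉ A, i ≠ j →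
      g A + g (insert i (insert j A)) ≤ g (insert i A) + g (insert j A)) :
    IsPolymatroid g := by
  have mono : ∀ A C : Finset M, Disjoint C A → g A ≤ g (C ∪ A) := by
    intro A C
    induction C using Finset.induction_on with
    | empty => simp
    | insert i C hi ih =>
      intro hd
      rw [Finset.disjoint_insert_left] at hd
      rw [Finset.insert_union]
      exact (ih hd.2).trans (hm _ i (by simp [hi, hd.1]))
  have step : ∀ i, ∀ A C : Finset M, Disjoint C A → i ∉ A → i ∉ C →
      g A + g (insert i (C ∪ A)) ≤ g (insert i A) + g (C ∪ A) := by
    intro i A C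
    induction C using Finset.induction_on with
    | empty => simp [add_comm]
    | insert j C hj ih =>
      intro hd hiA hiC
      rw [Finset.disjoint_insert_left] at hd
      rw [Finset.mem_insert, not_or] at hiC
      have h₁ := ih hd.2 hiA hiC.2
      have h₂ := hs (C ∪ A) i (by simp [hiA, hiC.2]) j (by simp [hj, hd.1]) hiC.1
      rw [Finset.insert_union]
      linarith
  have sub : ∀ A C E : Finset M, Disjoint C A → Disjoint E A → Disjoint C E →
      g A + g (E ∪ (C ∪ A)) ≤ g (E ∪ A) + g (C ∪ A) := by
    intro A C E
    induction E using Finset.induction_on with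
    | empty => simp
    | insert i E hi ih =>
      intro hC hE hCE
      rw [Finset.disjoint_insert_left] at hE
      rw [Finset.disjoint_insert_right] at hCE
      have h₁ := ih hC hE.2 hCE.2
      have h₂ := step i (E ∪ A) C (Finset.disjoint_union_right.2 ⟨hCE.2, hC⟩)
        (by simp [hi, hE.1]) hCE.1
      rw [Finset.insert_union, Finset.insert_union]
      rw [Finset.union_left_comm C E A] at h₂
      linarith
  refine ⟨h₀, fun A B h => ?_, fun A B => ?_⟩
  · have := mono A (B \ A) Finset.sdiff_disjoint
    rwa [Finset.sdiff_union_of_subset h] at this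
  · have := sub (A ∩ B) (B \ A) (A \ B)
      (Finset.disjoint_left.2 fun x => by simp; tauto)
      (Finset.disjoint_left.2 fun x => by simp; tauto)
      (Finset.disjoint_left.2 fun x => by simp; tauto)
    have e₁ : A \ B ∪ (B \ A ∪ A ∩ B) = A ∪ B := by
      ext x
      simp only [Finset.mem_union, Finset.mem_sdiff, Finset.mem_inter]
      tauto
    have e₂ : A \ B ∪ A ∩ B = A := by
      ext x
      simp only [Finset.mem_union, Finset.mem_sdiff, Finset.mem_inter]
      tauto
    have e₃ : B \ A ∪ A ∩ B = B := by
      ext x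
      simp only [Finset.mem_union, Finset.mem_sdiff, Finset.mem_inter]
      tauto
    rwa [e₁, e₂, e₃] at this

/-- Twice the set function with value `s i` at `{i}`, `q i j` at `{i, j}` and `t` at all sets with
at least three elements. -/
def pairFn {R M : Type*} [CommRing R] [DecidableEq M] (s : M → R) (q : M → M → R) (t : R)
    (A : Finset M) : R :=
  match A.card with
  | 0 => 0
  | 1 => 2 * ∑ i ∈ A, s i
  | 2 => ∑ p ∈ A.offDiag, q p.1 p.2
  | _ => 2 * t

section pairFn

variable {R M : Type*} [CommRing R] [DecidableEq M] (s : M → R) (q : M → M → R) (t : R)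

theorem pairFn_empty : pairFn s q t ∅ = 0 := by
  simp [pairFn]

theorem pairFn_singleton (i : M) : pairFn s q t {i} = 2 * s i := by
  simp [pairFn]

theorem pairFn_pair {i j : M} (h : i ≠ j) : pairFn s q t {i, j} = q i j + q j i := by
  have e : ({i, j} : Finset M).offDiag = {(i, j), (j, i)} := by
    ext ⟨a, b⟩
    simp only [Finset.mem_offDiag, Finset.mem_insert, Finset.mem_singleton, Prod.mk.injEq]
    constructor
    · rintro ⟨rfl | rfl, rfl | rfl, h⟩ <;> simp_all
    · rintro (⟨rfl, rfl⟩ | ⟨rfl, rfl⟩) <;> simp [h, h.symm]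
  rw [pairFn, Finset.card_pair h]
  simp only [e]
  rw [Finset.sum_pair (by simp [h])]

theorem pairFn_of_three_le {A : Finset M} (h : 3 ≤ A.card) : pairFn s q t A = 2 * t := by
  obtain ⟨n, hn⟩ := Nat.exists_eq_add_of_le' h
  simp [pairFn, hn]

/-- The diagonal of `q` is never read, so it can be redefined freely before pulling back along a
non-injective map. -/
theorem pairFn_congr {q' : M → M → R} (h : ∀ i j, i ≠ j → q i j = q' i j) (A : Finset M) :
    pairFn s q t A = pairFn s q' t A := by
  have : ∑ p ∈ A.offDiag, q p.1 p.2 = ∑ p ∈ A.offDiag, q' p.1 p.2 :=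
    Finset.sum_congr rfl fun p hp => h _ _ (Finset.mem_offDiag.1 hp).2.2
  simp [pairFn, this]

theorem pairFn_image {N : Type*} [DecidableEq N] (s : N → R) (q : N → N → R) (φ : M → N)
    {A : Finset M} (h : Set.InjOn φ A) :
    pairFn s q t (A.image φ) = pairFn (s ∘ φ) (fun i j => q (φ i) (φ j)) t A := by
  have h₁ : ∑ i ∈ A.image φ, s i = ∑ i ∈ A, (s ∘ φ) i := Finset.sum_image h
  have h₂ : ∑ p ∈ (A.image φ).offDiag, q p.1 p.2 = ∑ p ∈ A.offDiag, q (φ p.1) (φ p.2) := by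
    have e : (A.image φ).offDiag = A.offDiag.image (Prod.map φ φ) := by
      ext ⟨a, b⟩
      simp only [Finset.mem_offDiag, Finset.mem_image, Prod.exists, Prod.map_apply,
        Prod.mk.injEq]
      constructor
      · rintro ⟨⟨x, hx, rfl⟩, ⟨y, hy, rfl⟩, hne⟩
        exact ⟨x, y, ⟨hx, hy, fun e => hne (by rw [e])⟩, rfl, rfl⟩
      · rintro ⟨x, y, ⟨hx, hy, hne⟩, rfl, rfl⟩
        exact ⟨⟨x, hx, rfl⟩, ⟨y, hy, rfl⟩, fun e => hne (h hx hy e)⟩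
    rw [e, Finset.sum_image]
    · rfl
    · rintro ⟨a, b⟩ hp ⟨c, d⟩ hp' hpq
      simp only [Finset.coe_offDiag, Set.mem_offDiag] at hp hp'
      simp only [Prod.map_apply, Prod.mk.injEq] at hpq
      exact Prod.ext (h hp.1 hp'.1 hpq.1) (h hp.2.1 hp'.2.1 hpq.2)
  rw [pairFn, pairFn, Finset.card_image_of_injOn h, h₁, h₂]

theorem map_pairFn {S : Type*} [CommRing S] (f : R →+* S) (A : Finset M) :
    f (pairFn s q t A) = pairFn (fun i => f (s i)) (fun i j => f (q i j)) (f t) A := by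
  unfold pairFn
  split <;> simp [map_ofNat]

end pairFn

/-- By `isPolymatroid_of_insert` only small sets matter; `h₄` is submodularity for two pairs meeting
in k, whose union already has the top value. The hypotheses include equal indices because after a
pullback `q i i` is the value at two distinct elements over i. -/
theorem isPolymatroid_pairFn {M : Type*} [DecidableEq M] {s : M → ℝ} {q : M → M → ℝ} {t : ℝ}
    (h₁ : ∀ i j, s i ≤ q i j) (h₂ : ∀ i j, q i j ≤ t) (h₃ : ∀ i j, q i j ≤ s i + s j)
    (h₄ : ∀ i j k, s k + t ≤ q i k + q j k) (hq : ∀ i j, q i j = q j i) :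
    IsPolymatroid (pairFn s q t) := by
  have h₀ : ∀ i, 0 ≤ s i := fun i => by linarith [h₁ i i, h₃ i i]
  refine isPolymatroid_of_insert _ (pairFn_empty s q t) (fun A i hi => ?_)
    fun A i hi j hj hij => ?_
  · obtain h | h | h | h : A.card = 0 ∨ A.card = 1 ∨ A.card = 2 ∨ 3 ≤ A.card := by omega
    · obtain rfl := Finset.card_eq_zero.1 h
      rw [insert_empty_eq, pairFn_empty, pairFn_singleton]
      linarith [h₀ i]
    · obtain ⟨j, rfl⟩ := Finset.card_eq_one.1 h
      rw [pairFn_singleton, pairFn_pair _ _ _ (by simpa using hi)]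
      linarith [h₁ j i, hq i j]
    · obtain ⟨j, k, hjk, rfl⟩ := Finset.card_eq_two.1 h
      rw [pairFn_pair _ _ _ hjk, pairFn_of_three_le]
      · linarith [h₂ j k, h₂ k j]
      · rw [Finset.card_insert_of_notMem hi, h]
    · rw [pairFn_of_three_le _ _ _ h, pairFn_of_three_le]
      exact h.trans (Finset.card_le_card (Finset.subset_insert i A))
  · have hi' : i ∉ insert j A := by simp [hij, hi]
    have ci := Finset.card_insert_of_notMem hi
    have cj := Finset.card_insert_of_notMem hj
    have cij := Finset.card_insert_of_notMem hi'
    obtain h | h | h | h : A.card = 0 ∨ A.card = 1 ∨ A.card = 2 ∨ 3 ≤ A.card := by omega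
    · obtain rfl := Finset.card_eq_zero.1 h
      rw [insert_empty_eq, insert_empty_eq, pairFn_empty, pairFn_singleton, pairFn_singleton,
        pairFn_pair _ _ _ hij]
      linarith [h₃ i j, hq i j]
    · obtain ⟨k, rfl⟩ := Finset.card_eq_one.1 h
      rw [pairFn_singleton, pairFn_pair _ _ _ (by simpa using hi),
        pairFn_pair _ _ _ (by simpa using hj), pairFn_of_three_le _ _ _ (by omega)]
      linarith [h₄ i j k, hq i k, hq j k]
    · obtain ⟨k, l, hkl, rfl⟩ := Finset.card_eq_two.1 h
      rw [pairFn_pair _ _ _ hkl, pairFn_of_three_le _ _ _ (by omega),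
        pairFn_of_three_le _ _ _ (by omega), pairFn_of_three_le _ _ _ (by omega)]
      linarith [h₂ k l, h₂ l k]
    · rw [pairFn_of_three_le _ _ _ (by omega), pairFn_of_three_le _ _ _ (by omega),
        pairFn_of_three_le _ _ _ (by omega), pairFn_of_three_le _ _ _ (by omega)]

theorem pairFn_mem_gmaxeCone {M N : Type*} [Fintype M] [DecidableEq M] [DecidableEq N]
    {φ : M → N} {𝓣 : Set (Finset M)} (h𝓣 : ∀ T ∈ 𝓣, Set.InjOn φ (T : Set M))
    (hD : ∀ X Y D : Finset M, IsThreePartition X Y D → Separates X Y 𝓣 → 3 ≤ D.card)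
    {s : N → ℝ} {q : N → N → ℝ} {t : ℝ}
    (h₁ : ∀ i j, s i ≤ q i j) (h₂ : ∀ i j, q i j ≤ t) (h₃ : ∀ i j, q i j ≤ s i + s j)
    (h₄ : ∀ i j k, s k + t ≤ q i k + q j k) (hq : ∀ i j, q i j = q j i) :
    pairFn s q t ∈ gmaxeCone φ 𝓣 := by
  refine ⟨pairFn (s ∘ φ) (fun i j => q (φ i) (φ j)) t, isPolymatroid_pairFn (fun _ _ => h₁ _ _)
    (fun _ _ => h₂ _ _) (fun _ _ => h₃ _ _) (fun _ _ _ => h₄ _ _ _) (fun _ _ => hq _ _),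
    fun T hT A hA => ?_, fun X Y D h hs => ?_⟩
  · exact (pairFn_image t s q φ ((h𝓣 T hT).mono (by exact_mod_cast hA))).symm
  · have hc := hD X Y D h hs
    have hle : ∀ B : Finset M, 3 ≤ (B ∪ D).card := fun B =>
      hc.trans (Finset.card_le_card Finset.subset_union_right)
    rw [condMutualInfo, pairFn_of_three_le _ _ _ (hle X), pairFn_of_three_le _ _ _ (hle Y),
      pairFn_of_three_le _ _ _ hc, pairFn_of_three_le _ _ _ (hle (X ∪ Y))]
    ring

/-! ### Finitely generated cones and certified double description -/

/-- The double description step: the part of a finitely generated cone in a half-space is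
generated by the generators in the half-space and the combinations on its boundary of a generator
inside and a generator outside. -/
theorem mem_span_of_halfspace {E : Type*} [AddCommGroup E] [Module ℝ E] {S S' : Set E}
    (h : E →ₗ[ℝ] ℝ) (hS : ∀ r ∈ S, 0 ≤ h r → r ∈ Submodule.span ℝ≥0 S')
    (hc : ∀ p ∈ S, ∀ m ∈ S, 0 < h p → h m < 0 → h p • m - h m • p ∈ Submodule.span ℝ≥0 S')
    {x : E} (hx : x ∈ Submodule.span ℝ≥0 S) (h0 : 0 ≤ h x) : x ∈ Submodule.span ℝ≥0 S' := by
  have hunion : S = {r ∈ S | 0 ≤ h r} ∪ {r ∈ S | h r < 0} := by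
    ext r
    simp only [Set.mem_union, Set.mem_ofPred_eq]
    have := le_or_gt 0 (h r)
    tauto
  rw [hunion, Submodule.span_union, Submodule.mem_sup] at hx
  obtain ⟨y, hy, z, hz, rfl⟩ := hx
  have smul_mem : ∀ (c : ℝ) (v : E), 0 ≤ c → v ∈ Submodule.span ℝ≥0 S' →
      c • v ∈ Submodule.span ℝ≥0 S' := fun c v hc hv =>
    (Submodule.span ℝ≥0 S').smul_mem ⟨c, hc⟩ hv
  have hy' : y ∈ Submodule.span ℝ≥0 S' ∧ 0 ≤ h y := by
    refine Submodule.span_induction (fun r hr => ⟨hS r hr.1 hr.2, hr.2⟩) (by simp)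
      (fun u v _ _ hu hv => ⟨add_mem hu.1 hv.1, ?_⟩)
      (fun c u _ hu => ⟨Submodule.smul_mem _ c hu.1, ?_⟩) hy
    · rw [map_add]
      exact add_nonneg hu.2 hv.2
    · rw [NNReal.smul_def, map_smul]
      exact mul_nonneg c.2 hu.2
  have hz' : z = 0 ∨ h z < 0 := by
    refine Submodule.span_induction (fun r hr => Or.inr hr.2) (by simp)
      (fun u v _ _ hu hv => ?_) (fun c u _ hu => ?_) hz
    · rcases hu with rfl | hu
      · simpa using hv
      · rcases hv with rfl | hv
        · simpa using Or.inr hu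
        · right
          rw [map_add]
          exact add_neg hu hv
    · rcases hu with rfl | hu
      · simp
      · rcases eq_or_ne c 0 with rfl | hc0
        · simp
        · right
          rw [NNReal.smul_def, map_smul]
          exact mul_neg_of_pos_of_neg (by positivity) hu
  rcases hz' with rfl | hz0
  · simpa using hy'.1
  -- The expression is bilinear in y and z, so it reduces to pairs of generators; generators p with
  -- h p = 0 contribute only a non-negative multiple of p.
  have hcomb : h y • z - h z • y ∈ Submodule.span ℝ≥0 S' := by
    refine Submodule.span_induction₂ (p := fun y z _ _ => h y • z - h z • y ∈
      Submodule.span ℝ≥0 S') (fun p m hp hm => ?_) (by simp) (by simp) (fun a b c _ _ _ ha hb => ?_)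
      (fun a b c _ _ _ ha hb => ?_) (fun c a b _ _ ha => ?_) (fun c a b _ _ ha => ?_) hy hz
    · rcases hp.2.eq_or_lt with h' | h'
      · rw [← h', zero_smul, zero_sub, ← neg_smul]
        exact smul_mem _ _ (neg_nonneg.2 hm.2.le) (hS p hp.1 hp.2)
      · exact hc p hp.1 m hm.1 h' hm.2
    · convert add_mem ha hb using 1
      rw [map_add]
      module
    · convert add_mem ha hb using 1
      rw [map_add]
      module
    · convert Submodule.smul_mem _ c ha using 1
      simp only [NNReal.smul_def, map_smul, smul_eq_mul]
      module
    · convert Submodule.smul_mem _ c ha using 1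
      simp only [NNReal.smul_def, map_smul, smul_eq_mul]
      module
  rw [map_add] at h0
  have hpos : 0 < h y := by linarith
  have e : y + z = (h y)⁻¹ • ((h y • z - h z • y) + (h y + h z) • y) := by
    have : h y • z - h z • y + (h y + h z) • y = h y • (y + z) := by module
    rw [this, smul_smul, inv_mul_cancel₀ hpos.ne', one_smul]
  rw [e]
  exact smul_mem _ _ (by positivity) (add_mem hcomb (smul_mem _ _ h0 hy'.1))

namespace DoubleDescription

/-- A list of natural numbers as a real vector. -/
def toVec (v : List ℕ) (i : ℕ) : ℝ := v.getD i 0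

def addVec : List ℕ → List ℕ → List ℕ
  | [], b => b
  | a, [] => a
  | x :: a, y :: b => (x + y) :: addVec a b

def subVec : List ℕ → List ℕ → Option (List ℕ)
  | a, [] => some a
  | [], _ :: _ => none
  | x :: a, y :: b => if y ≤ x then (subVec a b).map ((x - y) :: ·) else none

/-- A constraint `(P, Q)` stands for the inequality `∑ i ∈ Q, x i ≤ ∑ i ∈ P, x i`. -/
abbrev Constraint := List ℕ × List ℕ

def coordSum (I v : List ℕ) : ℕ := (I.map fun i => v.getD i 0).sum

def Constraint.holds (c : Constraint) (v : List ℕ) : Bool := coordSum c.2 v ≤ coordSum c.1 v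

/-- Subtract `r` from `v` at most `n` times, as long as the constraints hold. -/
def peel (C : List Constraint) (r : List ℕ) : ℕ → List ℕ → List ℕ
  | 0, v => v
  | n + 1, v =>
    match subVec v r with
    | none => v
    | some w => if C.all (fun c => c.holds w) then peel C r n w else v

/-- A greedy test whether `v` is a non-negative integer combination of the vectors in `R`. -/
def decomposes (C : List Constraint) : List (List ℕ) → List ℕ → Bool
  | [], v => v.all (· == 0)
  -- The bound 9 only limits the search: too small a value could make the test fail, never succeed
  -- wrongly.
  | r :: R, v => decomposes C R (peel C r 9 v)

/-- The part of the cone generated by `R` where `c` holds is generated by `R'`, according to the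
greedy test. -/
def checkStep (C : List Constraint) (c : Constraint) (R R' : List (List ℕ)) : Bool :=
  R.all fun p => coordSum c.1 p ≤ coordSum c.2 p || R.all fun m => c.holds m ||
    decomposes C R' (addVec (m.map ((coordSum c.1 p - coordSum c.2 p) * ·))
      (p.map ((coordSum c.2 m - coordSum c.1 m) * ·)))

/-- The vector of the eleven decimal digits of a number. -/
def digits (n : ℕ) : List ℕ := (List.range 11).map fun i => n / 10 ^ (10 - i) % 10

/-- Run the double description method on a list of constraints, each with the new generators. -/
def run : List (Constraint × List ℕ) → List Constraint → List (List ℕ) → Option (List (List ℕ))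
  | [], _, R => some R
  | (c, new) :: steps, C, R =>
    -- The new generators come first, so the greedy test tries them before the old ones.
    let R' := new.map digits ++ R.filter c.holds
    if checkStep (c :: C) c R R' then run steps (c :: C) R' else none

theorem toVec_nil : toVec [] = 0 := by
  ext i
  simp [toVec]

theorem toVec_cons_zero (x : ℕ) (v : List ℕ) : toVec (x :: v) 0 = x := by
  simp [toVec]

theorem toVec_cons_succ (x : ℕ) (v : List ℕ) (i : ℕ) : toVec (x :: v) (i + 1) = toVec v i := by
  simp [toVec]

theorem toVec_addVec (a b : List ℕ) : toVec (addVec a b) = toVec a + toVec b := by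
  induction a, b using addVec.induct with
  | case1 b => simp [addVec, toVec_nil]
  | case2 a h => cases a <;> simp [addVec, toVec_nil]
  | case3 x a y b ih =>
    ext i
    rw [addVec]
    cases i with
    | zero => simp [toVec_cons_zero]
    | succ i => simp [toVec_cons_succ, ih]

theorem toVec_map_mul (k : ℕ) (v : List ℕ) : toVec (v.map (k * ·)) = (k : ℝ) • toVec v := by
  ext i
  simp only [toVec, Pi.smul_apply, smul_eq_mul, List.getD_eq_getElem?_getD, List.getElem?_map]
  cases v[i]? <;> simp

theorem toVec_of_subVec {v r w : List ℕ} (h : subVec v r = some w) :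
    toVec v = toVec w + toVec r := by
  induction v, r using subVec.induct generalizing w with
  | case1 a =>
    simp only [subVec, Option.some.injEq] at h
    simp [h, toVec_nil]
  | case2 => simp [subVec] at h
  | case3 x a y b hle ih =>
    simp only [subVec, hle, if_true, Option.map_eq_some_iff] at h
    obtain ⟨w', hw', rfl⟩ := h
    ext i
    cases i with
    | zero => simp [toVec_cons_zero, hle]
    | succ i => simp [toVec_cons_succ, ih hw']
  | case4 x a y b hle => simp [subVec, hle] at h

/-- The cone generated by a list of vectors. -/
noncomputable def cone (R : List (List ℕ)) : Submodule ℝ≥0 (ℕ → ℝ) :=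
  Submodule.span ℝ≥0 (toVec '' {r | r ∈ R})

theorem toVec_mem_cone {R : List (List ℕ)} {r : List ℕ} (h : r ∈ R) : toVec r ∈ cone R :=
  Submodule.subset_span ⟨r, h, rfl⟩

/-- Every successful subtraction writes the vector as the remainder plus r. The constraints in `C`
merely steer the search, so nothing about them is needed for soundness. -/
theorem peel_mem {S : Submodule ℝ≥0 (ℕ → ℝ)} {C : List Constraint} {r : List ℕ}
    (hr : toVec r ∈ S) (n : ℕ) (v : List ℕ) (h : toVec (peel C r n v) ∈ S) : toVec v ∈ S := by
  induction n generalizing v with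
  | zero => exact h
  | succ n ih =>
    rw [peel] at h
    split at h
    · exact h
    · rename_i w hw
      split at h
      · rw [toVec_of_subVec hw]
        exact add_mem (ih w h) hr
      · exact h

theorem decomposes_mem {S : Submodule ℝ≥0 (ℕ → ℝ)} {C : List Constraint} {R : List (List ℕ)}
    (hR : ∀ r ∈ R, toVec r ∈ S) {v : List ℕ} (h : decomposes C R v = true) : toVec v ∈ S := by
  induction R generalizing v with
  | nil =>
    have : toVec v = 0 := by
      ext i
      simp only [decomposes, List.all_eq_true, beq_iff_eq] at h
      simp only [toVec, List.getD_eq_getElem?_getD, Pi.zero_apply, Nat.cast_eq_zero]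
      rcases hv : v[i]? with _ | x
      · rfl
      · exact h x (List.mem_of_getElem? hv)
    rw [this]
    exact zero_mem S
  | cons r R ih =>
    exact peel_mem (hR r (by simp)) 9 v (ih (fun r' hr' => hR r' (by simp [hr'])) h)

/-- The sum of the coordinates in a list as a linear form. -/
noncomputable def coordForm (I : List ℕ) : (ℕ → ℝ) →ₗ[ℝ] ℝ :=
  (I.map fun i => LinearMap.proj i).sum

theorem coordForm_apply (I : List ℕ) (x : ℕ → ℝ) : coordForm I x = (I.map x).sum := by
  induction I with
  | nil => simp [coordForm]
  | cons i I ih =>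
    rw [List.map_cons, List.sum_cons, ← ih]
    simp [coordForm]

theorem coordForm_toVec (I v : List ℕ) : coordForm I (toVec v) = coordSum I v := by
  rw [coordForm_apply, coordSum, Nat.cast_list_sum, List.map_map]
  rfl

theorem mem_cone_of_checkStep {C : List Constraint} {c : Constraint} {R R' : List (List ℕ)}
    (hR : ∀ r ∈ R, c.holds r = true → r ∈ R') (h : checkStep C c R R' = true)
    {x : ℕ → ℝ} (hx : x ∈ cone R) (hc : (c.2.map x).sum ≤ (c.1.map x).sum) : x ∈ cone R' := by
  refine mem_span_of_halfspace (coordForm c.1 - coordForm c.2) ?_ ?_ hx ?_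
  · rintro _ ⟨r, hr, rfl⟩ h0
    rw [LinearMap.sub_apply, coordForm_toVec, coordForm_toVec, sub_nonneg, Nat.cast_le] at h0
    exact toVec_mem_cone (hR r hr (by simpa [Constraint.holds] using h0))
  · rintro _ ⟨p, hp, rfl⟩ _ ⟨m, hm, rfl⟩ h1 h2
    rw [LinearMap.sub_apply, coordForm_toVec, coordForm_toVec] at h1 h2 ⊢
    rw [LinearMap.sub_apply, coordForm_toVec, coordForm_toVec]
    have h1' : coordSum c.2 p < coordSum c.1 p := by exact_mod_cast sub_pos.1 h1
    have h2' : coordSum c.1 m < coordSum c.2 m := by exact_mod_cast sub_neg.1 h2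
    simp only [checkStep, List.all_eq_true, Bool.or_eq_true, decide_eq_true_eq,
      Constraint.holds] at h
    have hd := ((h p hp).resolve_left (by omega) m hm).resolve_left (by omega)
    have := decomposes_mem (S := cone R') (fun r hr => toVec_mem_cone hr) hd
    rw [toVec_addVec, toVec_map_mul, toVec_map_mul, Nat.cast_sub h1'.le,
      Nat.cast_sub h2'.le] at this
    rw [sub_eq_add_neg _ ((_ : ℝ) • toVec p), ← neg_smul, neg_sub]
    exact this
  · rw [LinearMap.sub_apply, coordForm_apply, coordForm_apply]
    linarith

theorem mem_cone_of_run {steps : List (Constraint × List ℕ)} {C : List Constraint}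
    {R R' : List (List ℕ)} (h : run steps C R = some R') {x : ℕ → ℝ} (hx : x ∈ cone R)
    (hc : ∀ s ∈ steps, (s.1.2.map x).sum ≤ (s.1.1.map x).sum) : x ∈ cone R' := by
  induction steps generalizing C R with
  | nil =>
    simp only [run, Option.some.injEq] at h
    rwa [← h]
  | cons s steps ih =>
    obtain ⟨c, new⟩ := s
    simp only [run] at h
    split at h
    · rename_i hstep
      refine ih h (mem_cone_of_checkStep (fun r hr hr' => ?_) hstep hx (hc (c, new) (by simp)))
        fun s hs => hc s (by simp [hs])
      exact List.mem_append_right _ (List.mem_filter.2 ⟨hr, hr'⟩)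
    · simp at h

/-- This supplies the initial cone of the computation, the non-negative orthant. -/
theorem mem_cone_unit {n : ℕ} {x : ℕ → ℝ} (h0 : ∀ i < n, 0 ≤ x i) (hx : ∀ i, n ≤ i → x i = 0) :
    x ∈ cone ((List.range n).map fun i =>
      List.replicate i 0 ++ 1 :: List.replicate (n - 1 - i) 0) := by
  have e : x = ∑ i ∈ Finset.range n, x i •
      toVec (List.replicate i 0 ++ 1 :: List.replicate (n - 1 - i) 0) := by
    have hv : ∀ k i j, toVec (List.replicate i 0 ++ 1 :: List.replicate k 0) j =
        if j = i then 1 else 0 := by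
      intro k i j
      induction i generalizing j with
      | zero =>
        cases j with
        | zero => simp [toVec]
        | succ j =>
          rw [List.replicate_zero, List.nil_append, toVec_cons_succ]
          simp only [toVec, List.getD_eq_getElem?_getD, List.getElem?_replicate]
          split <;> simp
      | succ i ih =>
        rw [List.replicate_succ, List.cons_append]
        cases j with
        | zero => simp [toVec_cons_zero]
        | succ j => simp [toVec_cons_succ, ih]
    ext j
    simp only [Finset.sum_apply, Pi.smul_apply, hv, smul_eq_mul, mul_ite, mul_one, mul_zero,
      Finset.sum_ite_eq, Finset.mem_range]
    split
    · rfl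
    · exact hx j (by omega)
  rw [e]
  refine sum_mem fun i hi => ?_
  exact (cone _).smul_mem ⟨x i, h0 i (Finset.mem_range.1 hi)⟩
    (toVec_mem_cone (List.mem_map.2 ⟨i, List.mem_range.2 (Finset.mem_range.1 hi), rfl⟩))

end DoubleDescription

/-! ### Ranks in the plane over the field with two elements -/

theorem vectorRank_zmod_two {M : Type*} [DecidableEq M] (v : M → ZMod 2 × ZMod 2)
    (A : Finset M) : vectorRank (ZMod 2) v A = min 2 ((A.image v).erase 0).card := by
  set S := (A.image v).erase 0 with hS
  have hspan : vectorRank (ZMod 2) v A =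
      Module.finrank (ZMod 2) (Submodule.span (ZMod 2) (S : Set (ZMod 2 × ZMod 2))) := by
    rw [vectorRank, hS, Finset.coe_erase, Submodule.span_sdiff_singleton_zero, Finset.coe_image]
  rw [hspan]
  obtain h | h | h : S.card = 0 ∨ S.card = 1 ∨ 1 < S.card := by omega
  · rw [Finset.card_eq_zero.1 h]
    simp
  · obtain ⟨a, ha⟩ := Finset.card_eq_one.1 h
    have ha0 : a ≠ 0 := by
      have : a ∈ S := by simp [ha]
      exact (Finset.mem_erase.1 this).1
    rw [ha, Finset.coe_singleton, finrank_span_singleton ha0]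
    simp
  · obtain ⟨a, ha, b, hb, hab⟩ := Finset.one_lt_card.1 h
    -- Over a field whose only nonzero scalar is 1, two distinct nonzero vectors are independent.
    -- Thus rank becomes a count that can be decided.
    have hli : LinearIndependent (ZMod 2) ![a, b] := by
      have key : ∀ a b : ZMod 2 × ZMod 2, a ≠ 0 → b ≠ 0 → a ≠ b →
          ∀ s t : ZMod 2, s • a + t • b = 0 → s = 0 ∧ t = 0 := by decide
      exact LinearIndependent.pair_iff.2
        (key a b (Finset.mem_erase.1 ha).1 (Finset.mem_erase.1 hb).1 hab)
    have h₁ := finrank_span_eq_card hli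
    rw [Fintype.card_fin] at h₁
    have h₂ : Module.finrank (ZMod 2) (Submodule.span (ZMod 2) (Set.range ![a, b])) ≤
        Module.finrank (ZMod 2) (Submodule.span (ZMod 2) (S : Set (ZMod 2 × ZMod 2))) := by
      refine Submodule.finrank_mono (Submodule.span_mono ?_)
      rintro _ ⟨i, rfl⟩
      fin_cases i
      · exact ha
      · exact hb
    have h₃ := Submodule.finrank_le
      (Submodule.span (ZMod 2) (S : Set (ZMod 2 × ZMod 2)))
    rw [Module.finrank_prod, Module.finrank_self] at h₃
    omega

/-! ### Generators of the tight cone on four elements -/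

namespace FourElements

open DoubleDescription

/-- The index of the pair `{a, b}` in the order `01, 02, 03, 12, 13, 23`. -/
def pairIndex (a b : Fin 4) : ℕ :=
  if (a : ℕ) = 0 ∨ (b : ℕ) = 0 then a + b - 1 else a + b

/-- The set function with coordinates `x`: twice the value is `x 10` at large sets, with deficits
`x 6, …, x 9` at the singletons and `x 0, …, x 5` at the pairs. -/
def ofCoords {R : Type*} [CommRing R] (x : ℕ → R) : Finset (Fin 4) → R :=
  pairFn (fun a => x 10 - x (6 + a)) (fun a b => x 10 - x (pairIndex a b)) (x 10)

theorem ofCoords_add (x y : ℕ → ℝ) : ofCoords (x + y) = ofCoords x + ofCoords y := by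
  ext A
  simp only [ofCoords, pairFn, Pi.add_apply]
  split
  · simp
  · simp only [Finset.sum_sub_distrib, Finset.sum_add_distrib]
    ring
  · simp only [Finset.sum_sub_distrib, Finset.sum_add_distrib]
    ring
  · ring

theorem ofCoords_smul (c : ℝ≥0) (x : ℕ → ℝ) : ofCoords (c • x) = c • ofCoords x := by
  ext A
  simp only [ofCoords, pairFn, Pi.smul_apply, NNReal.smul_def, smul_eq_mul, ← mul_sub,
    ← Finset.mul_sum]
  split
  · simp
  · ring
  · rfl
  · ring

/-- The rays are integral, so their properties can be decided over ℤ and transferred to ℝ. -/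
theorem ofCoords_toVec (r : List ℕ) (A : Finset (Fin 4)) :
    ofCoords (toVec r) A = ((ofCoords (fun i => (r.getD i 0 : ℤ)) A : ℤ) : ℝ) := by
  have := map_pairFn (fun a : Fin 4 => ((r.getD 10 0 : ℤ) - (r.getD (6 + a) 0 : ℤ)))
    (fun a b => ((r.getD 10 0 : ℤ) - (r.getD (pairIndex a b) 0 : ℤ))) (r.getD 10 0 : ℤ)
    (Int.castRingHom ℝ) A
  simp only [eq_intCast, Int.cast_sub, Int.cast_natCast] at this
  exact this.symm

/-- The labellings of the four elements by vectors of the plane over `ZMod 2` whose rank functions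
are extreme. -/
def labellings : List (Fin 4 → ZMod 2 × ZMod 2) :=
  let o : ZMod 2 × ZMod 2 := 0
  let a : ZMod 2 × ZMod 2 := (1, 0)
  let b : ZMod 2 × ZMod 2 := (0, 1)
  let c : ZMod 2 × ZMod 2 := (1, 1)
  [![o, o, a, a], ![o, a, o, a], ![o, a, a, o], ![a, o, o, a], ![a, o, a, o], ![a, a, o, o],
    ![o, a, a, a], ![a, o, a, a], ![a, a, o, a], ![a, a, a, o],
    ![o, a, b, c], ![a, o, b, c], ![a, b, o, c], ![a, b, c, o],
    ![a, a, b, c], ![a, b, a, c], ![a, b, c, a], ![b, a, a, c], ![b, a, c, a], ![b, c, a, a]]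

/-- Whether the vector `r` gives the rank function of a labelling. -/
def IsLabelRank (r : List ℕ) : Prop :=
  ∃ v ∈ labellings, ∀ A : Finset (Fin 4), ofCoords (fun i => (r.getD i 0 : ℤ)) A =
    2 * min 2 ((A.image v).erase 0).card

/-- The value at pairs, completed by the value at a pair of elements with the same image. -/
def fullPair (r : List ℕ) (a b : Fin 4) : ℤ :=
  -- This is the largest value that subadditivity and the top value allow. Every other condition on
  -- the diagonal is a lower bound, so no choice does better.
  if a = b then min (2 * ((r.getD 10 0 : ℤ) - (r.getD (6 + a) 0 : ℤ))) (r.getD 10 0 : ℤ)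
  else (r.getD 10 0 : ℤ) - (r.getD (pairIndex a b) 0 : ℤ)

/-- Whether the extension of the set function of `r` which is constant on the sets with at least
three elements is a polymatroid. -/
def IsFlat (r : List ℕ) : Prop :=
  let s := fun a : Fin 4 => (r.getD 10 0 : ℤ) - (r.getD (6 + a) 0 : ℤ)
  let t : ℤ := (r.getD 10 0 : ℤ)
  ∀ a b, s a ≤ fullPair r a b ∧ fullPair r a b ≤ t ∧ fullPair r a b ≤ s a + s b ∧
    fullPair r a b = fullPair r b a ∧ ∀ c, s c + t ≤ fullPair r a c + fullPair r b c

instance (r : List ℕ) : Decidable (IsLabelRank r) := by unfold IsLabelRank; infer_instance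
instance (r : List ℕ) : Decidable (IsFlat r) := by unfold IsFlat; infer_instance

/-- The constraints on the coordinates of a polymatroid, with the new generators in the steps of
the double description method. -/
def steps : List (Constraint × List ℕ) := [
  -- With t the top value, the first twelve constraints say f(a) + t ≤ f(ab) + f(ac), and the last
  -- six say f(ab) ≤ f(a) + f(b). Generators are written with one decimal digit per coordinate,
  -- leading zeros dropped.
  (([6], [0, 1]), [10000010000, 1000010000]),
  (([6], [0, 2]), [1100010000, 100010000]),
  (([6], [1, 2]), [11100020000]),
  (([7], [0, 3]), [11100021000, 10000011000, 10001000]),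
  (([7], [0, 4]), [11001000, 1001000]),
  (([7], [3, 4]), [11111022000, 10011012000]),
  (([8], [1, 3]), [11111022200, 10011012100, 11100021100, 10001100, 1000010100]),
  (([8], [1, 5]), [11111122200, 10011112100, 10101100, 100100]),
  (([8], [3, 5]), [11110122200, 11011122200, 1010111200]),
  (([9], [2, 4]), [11110122210, 11011122210, 11111122220, 11111022220, 10011012110, 11100021110,
    1001010, 100010010]),
  (([9], [2, 5]), [10011112210, 1011112210, 1101110, 11110122220, 1010111210, 100110]),
  (([9], [4, 5]), [11101122220, 10111122220, 1111122220, 101111120, 11011122220]),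
  (([0, 10], [6, 7]), [11101122223, 10111122223, 1111122224, 101111122, 11011122223,
    11110122223, 1010111212, 11111122223, 11111022223, 10011012112, 11100021112, 1001011,
    100010011, 10001101, 1000010101, 10000011001, 10001, 1001]),
  (([1, 10], [6, 8]), [1101121, 1001111, 101111, 1101, 10111122224, 100111, 101]),
  (([2, 10], [6, 9]), [1111, 111, 11102222, 10001111, 1011, 11011122224, 11]),
  (([3, 10], [7, 8]), [100011122, 101011122, 100111122, 100011112, 11112, 11112223, 1011112,
    111112, 11102, 11101122224]),
  (([4, 10], [7, 9]), [11012223, 1100021223, 1100121223, 1010011212, 1000011112, 10011112,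
    11012, 11110122224]),
  (([5, 10], [8, 9]), [11010022213, 10101022123, 10000011112, 10112, 1112, 11111022224])]

/-- The extreme rays of the cone of coordinates. -/
def rays : List (List ℕ) := [
  11010022213, 10101022123, 10000011112, 10112, 1112, 11111022224, 1100121223, 1000011112,
  10011112, 11012, 11110122224, 100011112, 11112, 11112223, 1011112, 111112, 11102, 11101122224,
  11011122224, 11, 10111122224, 100111, 101, 1111122224, 101111122, 1010111212, 11111122223,
  10011012112, 11100021112, 1001011, 100010011, 10001101, 1000010101, 10000011001, 10001, 1001,
  1].map digits

theorem run_steps :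
    run steps [] ((List.range 11).map fun i =>
      List.replicate i 0 ++ 1 :: List.replicate (11 - 1 - i) 0) = some rays := by
  decide +kernel

theorem isLabelRank_or_isFlat : ∀ r ∈ rays, IsLabelRank r ∨ IsFlat r := by
  decide +kernel

theorem ofCoords_ray_mem {M : Type*} [Fintype M] [DecidableEq M] {φ : M → Fin 4}
    {𝓣 : Set (Finset M)} (h𝓣 : ∀ T ∈ 𝓣, Set.InjOn φ (T : Set M))
    (hD : ∀ X Y D : Finset M, IsThreePartition X Y D → Separates X Y 𝓣 → 3 ≤ D.card)
    {r : List ℕ} (hr : r ∈ rays) : ofCoords (toVec r) ∈ gmaxeCone φ 𝓣 := by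
  rcases isLabelRank_or_isFlat r hr with ⟨v, -, hv⟩ | h
  · have e : ofCoords (toVec r) =
        (2 : ℝ≥0) • fun A => (vectorRank (ZMod 2) v A : ℝ) := by
      ext A
      rw [ofCoords_toVec, hv, Pi.smul_apply, vectorRank_zmod_two, NNReal.smul_def]
      push_cast
      simp
    rw [e]
    exact Submodule.smul_mem _ _ (vectorRank_mem_gmaxeCone φ 𝓣 v)
  -- Off the diagonal nothing changes; the new diagonal makes the pullback to M a polymatroid.
  · have e : ofCoords (toVec r) = pairFn (fun a : Fin 4 => toVec r 10 - toVec r (6 + a))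
        (fun a b => (fullPair r a b : ℝ)) (toVec r 10) := by
      ext A
      refine pairFn_congr _ _ _ (fun a b hab => ?_) A
      simp [fullPair, hab, toVec]
    rw [e]
    refine pairFn_mem_gmaxeCone h𝓣 hD (fun a b => ?_) (fun a b => ?_) (fun a b => ?_)
      (fun a b c => ?_) (fun a b => ?_)
    · have := (h a b).1
      simp only [toVec]
      exact_mod_cast this
    · have := (h a b).2.1
      simp only [toVec]
      exact_mod_cast this
    · have := (h a b).2.2.1
      simp only [toVec]
      exact_mod_cast this
    · have := (h a b).2.2.2.2 c
      simp only [toVec]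
      exact_mod_cast this
    · exact_mod_cast (h a b).2.2.2.1

theorem ofCoords_mem {M : Type*} [Fintype M] [DecidableEq M] {φ : M → Fin 4}
    {𝓣 : Set (Finset M)} (h𝓣 : ∀ T ∈ 𝓣, Set.InjOn φ (T : Set M))
    (hD : ∀ X Y D : Finset M, IsThreePartition X Y D → Separates X Y 𝓣 → 3 ≤ D.card)
    {x : ℕ → ℝ} (h0 : ∀ i < 11, 0 ≤ x i) (hx : ∀ i, 11 ≤ i → x i = 0)
    (hc : ∀ s ∈ steps, (s.1.2.map x).sum ≤ (s.1.1.map x).sum) :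
    ofCoords x ∈ gmaxeCone φ 𝓣 := by
  refine Submodule.span_induction (p := fun x _ => ofCoords x ∈ gmaxeCone φ 𝓣) ?_ ?_
    (fun x y _ _ hx hy => ?_) (fun c x _ hx => ?_)
    (mem_cone_of_run run_steps (mem_cone_unit h0 hx) hc)
  · rintro _ ⟨r, hr, rfl⟩
    exact ofCoords_ray_mem h𝓣 hD hr
  · have : ofCoords (0 : ℕ → ℝ) = 0 := by simpa using ofCoords_smul 0 0
    rw [this]
    exact zero_mem _
  · rw [ofCoords_add]
    exact add_mem hx hy
  · rw [ofCoords_smul]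
    exact Submodule.smul_mem _ c hx

/-! ### Reduction to the tight part -/

/-- The increment of the rank of the base set at `a`. -/
def coatomGap (f : Finset (Fin 4) → ℝ) (a : Fin 4) : ℝ :=
  f Finset.univ - f (Finset.univ.erase a)

/-- The polymatroid `f` minus its modular part. -/
def tightPart (f : Finset (Fin 4) → ℝ) (A : Finset (Fin 4)) : ℝ :=
  f A - ∑ a ∈ A, coatomGap f a

/-- The coordinates of the tight part of `f`. -/
def coords (f : Finset (Fin 4) → ℝ) (i : ℕ) : ℝ :=
  let t := tightPart f Finset.univ
  [t - tightPart f {0, 1}, t - tightPart f {0, 2}, t - tightPart f {0, 3},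
    t - tightPart f {1, 2}, t - tightPart f {1, 3}, t - tightPart f {2, 3},
    t - tightPart f {0}, t - tightPart f {1}, t - tightPart f {2}, t - tightPart f {3},
    t].getD i 0

theorem eq_of_finset_fin_four : ∀ A : Finset (Fin 4),
    A = ∅ ∨ A = {0} ∨ A = {1} ∨ A = {2} ∨ A = {3} ∨ A = {0, 1} ∨ A = {0, 2} ∨ A = {0, 3} ∨
    A = {1, 2} ∨ A = {1, 3} ∨ A = {2, 3} ∨ A = {0, 1, 2} ∨ A = {0, 1, 3} ∨ A = {0, 2, 3} ∨
    A = {1, 2, 3} ∨ A = {0, 1, 2, 3} := by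
  decide

theorem univ_fin_four : (Finset.univ : Finset (Fin 4)) = {0, 1, 2, 3} := by decide

theorem coatomGap_eq (f : Finset (Fin 4) → ℝ) :
    coatomGap f 0 = f {0, 1, 2, 3} - f {1, 2, 3} ∧ coatomGap f 1 = f {0, 1, 2, 3} - f {0, 2, 3} ∧
    coatomGap f 2 = f {0, 1, 2, 3} - f {0, 1, 3} ∧
    coatomGap f 3 = f {0, 1, 2, 3} - f {0, 1, 2} := by
  have e₀ : Finset.univ.erase (0 : Fin 4) = {1, 2, 3} := by decide
  have e₁ : Finset.univ.erase (1 : Fin 4) = {0, 2, 3} := by decide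
  have e₂ : Finset.univ.erase (2 : Fin 4) = {0, 1, 3} := by decide
  have e₃ : Finset.univ.erase (3 : Fin 4) = {0, 1, 2} := by decide
  unfold coatomGap
  rw [e₀, e₁, e₂, e₃, univ_fin_four]
  exact ⟨rfl, rfl, rfl, rfl⟩

theorem ofCoords_coords {f : Finset (Fin 4) → ℝ} (hf : f ∅ = 0) (A : Finset (Fin 4)) :
    ofCoords (coords f) A = 2 * tightPart f A := by
  obtain ⟨h₀, h₁, h₂, h₃⟩ := coatomGap_eq f
  rcases eq_of_finset_fin_four A with
    rfl | rfl | rfl | rfl | rfl | rfl | rfl | rfl | rfl | rfl | rfl | rfl | rfl | rfl | rfl | rfl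
  · simp [ofCoords, pairFn_empty, tightPart, hf]
  iterate 4 · simp [ofCoords, pairFn_singleton, coords]
  iterate 6
    · rw [ofCoords, pairFn_pair _ _ _ (by decide)]
      simp [coords, pairIndex]
      ring
  -- Deleting one element from the base set does not change the tight part, so triples have the top
  -- value.
  iterate 4
    · rw [ofCoords, pairFn_of_three_le _ _ _ (by decide)]
      simp [coords, tightPart, univ_fin_four, h₀, h₁, h₂, h₃]
      ring
  · rw [ofCoords, pairFn_of_three_le _ _ _ (by decide)]
    simp [coords, univ_fin_four]

/-- The modular part cancels in every submodular inequality. The deficits are non-negative because,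
by submodularity, an increment at a is never below `coatomGap f a`. -/
theorem coords_constraints {f : Finset (Fin 4) → ℝ} (hf : IsPolymatroid f) :
    (∀ i < 11, 0 ≤ coords f i) ∧
      ∀ s ∈ steps, (s.1.2.map (coords f)).sum ≤ (s.1.1.map (coords f)).sum := by
  obtain ⟨h₀, h₁, h₂, h₃⟩ := coatomGap_eq f
  have sub : ∀ A B C E : Finset (Fin 4), A ∩ B = C → A ∪ B = E → f C + f E ≤ f A + f B := by
    rintro A B _ _ rfl rfl
    exact hf.submodular A B
  have z := hf.empty
  have a01 := sub {0} {1} ∅ {0, 1} (by decide) (by decide)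
  have a02 := sub {0} {2} ∅ {0, 2} (by decide) (by decide)
  have a03 := sub {0} {3} ∅ {0, 3} (by decide) (by decide)
  have a12 := sub {1} {2} ∅ {1, 2} (by decide) (by decide)
  have a13 := sub {1} {3} ∅ {1, 3} (by decide) (by decide)
  have a23 := sub {2} {3} ∅ {2, 3} (by decide) (by decide)
  have b012 := sub {0, 1} {0, 2} {0} {0, 1, 2} (by decide) (by decide)
  have b013 := sub {0, 1} {0, 3} {0} {0, 1, 3} (by decide) (by decide)
  have b023 := sub {0, 2} {0, 3} {0} {0, 2, 3} (by decide) (by decide)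
  have b102 := sub {0, 1} {1, 2} {1} {0, 1, 2} (by decide) (by decide)
  have b103 := sub {0, 1} {1, 3} {1} {0, 1, 3} (by decide) (by decide)
  have b123 := sub {1, 2} {1, 3} {1} {1, 2, 3} (by decide) (by decide)
  have b201 := sub {0, 2} {1, 2} {2} {0, 1, 2} (by decide) (by decide)
  have b203 := sub {0, 2} {2, 3} {2} {0, 2, 3} (by decide) (by decide)
  have b213 := sub {1, 2} {2, 3} {2} {1, 2, 3} (by decide) (by decide)
  have b301 := sub {0, 3} {1, 3} {3} {0, 1, 3} (by decide) (by decide)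
  have b302 := sub {0, 3} {2, 3} {3} {0, 2, 3} (by decide) (by decide)
  have b312 := sub {1, 3} {2, 3} {3} {1, 2, 3} (by decide) (by decide)
  have c01 := sub {0, 1, 2} {0, 1, 3} {0, 1} {0, 1, 2, 3} (by decide) (by decide)
  have c02 := sub {0, 1, 2} {0, 2, 3} {0, 2} {0, 1, 2, 3} (by decide) (by decide)
  have c03 := sub {0, 1, 3} {0, 2, 3} {0, 3} {0, 1, 2, 3} (by decide) (by decide)
  have c12 := sub {0, 1, 2} {1, 2, 3} {1, 2} {0, 1, 2, 3} (by decide) (by decide)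
  have c13 := sub {0, 1, 3} {1, 2, 3} {1, 3} {0, 1, 2, 3} (by decide) (by decide)
  have c23 := sub {0, 2, 3} {1, 2, 3} {2, 3} {0, 1, 2, 3} (by decide) (by decide)
  have t0 : tightPart f {0} = f {0} - coatomGap f 0 := by simp [tightPart]
  have t1 : tightPart f {1} = f {1} - coatomGap f 1 := by simp [tightPart]
  have t2 : tightPart f {2} = f {2} - coatomGap f 2 := by simp [tightPart]
  have t3 : tightPart f {3} = f {3} - coatomGap f 3 := by simp [tightPart]
  have t01 : tightPart f {0, 1} = f {0, 1} - (coatomGap f 0 + coatomGap f 1) := by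
    simp [tightPart]
  have t02 : tightPart f {0, 2} = f {0, 2} - (coatomGap f 0 + coatomGap f 2) := by
    simp [tightPart]
  have t03 : tightPart f {0, 3} = f {0, 3} - (coatomGap f 0 + coatomGap f 3) := by
    simp [tightPart]
  have t12 : tightPart f {1, 2} = f {1, 2} - (coatomGap f 1 + coatomGap f 2) := by
    simp [tightPart]
  have t13 : tightPart f {1, 3} = f {1, 3} - (coatomGap f 1 + coatomGap f 3) := by
    simp [tightPart]
  have t23 : tightPart f {2, 3} = f {2, 3} - (coatomGap f 2 + coatomGap f 3) := by
    simp [tightPart]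
  have tu : tightPart f Finset.univ = f {0, 1, 2, 3} -
      (coatomGap f 0 + coatomGap f 1 + coatomGap f 2 + coatomGap f 3) := by
    simp [tightPart, Fin.sum_univ_four, ← univ_fin_four]
  constructor
  · intro i hi
    interval_cases i <;> simp [coords, t0, t1, t2, t3, t01, t02, t03, t12, t13, t23, tu] <;>
      linarith
  · simp only [steps, List.forall_mem_cons, List.not_mem_nil, false_imp_iff, implies_true,
      List.map_cons, List.map_nil, List.sum_cons, List.sum_nil, coords, List.getD_cons_zero,
      List.getD_cons_succ, and_true, t0, t1, t2, t3, t01, t02, t03, t12, t13, t23, tu]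
    refine ⟨?_, ?_, ?_, ?_, ?_, ?_, ?_, ?_, ?_, ?_, ?_, ?_, ?_, ?_, ?_, ?_, ?_, ?_⟩ <;> linarith

theorem vectorRank_indicator (a : Fin 4) (A : Finset (Fin 4)) :
    vectorRank (ZMod 2) (fun b => if b = a then ((1, 0) : ZMod 2 × ZMod 2) else 0) A =
      if a ∈ A then 1 else 0 := by
  rw [vectorRank_zmod_two]
  revert a A
  decide

/-- Every polymatroid on four elements has a GMAXE extension if all separating 3-partitions have
a last piece with at least three elements. -/
theorem polymatroid_mem_gmaxeCone {M : Type*} [Fintype M] [DecidableEq M] {φ : M → Fin 4}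
    {𝓣 : Set (Finset M)} (h𝓣 : ∀ T ∈ 𝓣, Set.InjOn φ (T : Set M))
    (hD : ∀ X Y D : Finset M, IsThreePartition X Y D → Separates X Y 𝓣 → 3 ≤ D.card)
    {f : Finset (Fin 4) → ℝ} (hf : IsPolymatroid f) : f ∈ gmaxeCone φ 𝓣 := by
  obtain ⟨h₁, h₂⟩ := coords_constraints hf
  have hgap : ∀ a, 0 ≤ coatomGap f a := fun a =>
    sub_nonneg.2 (hf.mono _ _ (Finset.erase_subset _ _))
  have hx : ∀ i, 11 ≤ i → coords f i = 0 := fun i hi =>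
    List.getD_eq_default _ _ (by simpa using hi)
  -- The factor one half undoes the doubling in `pairFn`; monotonicity of f makes the modular
  -- weights non-negative.
  have e : f = (2⁻¹ : ℝ≥0) • ofCoords (coords f) +
      ∑ a, (coatomGap f a).toNNReal • fun A => (vectorRank (ZMod 2)
        (fun b => if b = a then ((1, 0) : ZMod 2 × ZMod 2) else 0) A : ℝ) := by
    ext A
    simp only [Pi.add_apply, Pi.smul_apply, Finset.sum_apply, NNReal.smul_def, smul_eq_mul,
      vectorRank_indicator, ofCoords_coords hf.empty, tightPart, Real.coe_toNNReal _ (hgap _), Nat.cast_ite,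
      Nat.cast_one, Nat.cast_zero, mul_ite, mul_one, mul_zero, Finset.sum_ite_mem,
      Finset.univ_inter, NNReal.coe_inv, NNReal.coe_ofNat]
    ring
  rw [e]
  exact add_mem (Submodule.smul_mem _ _ (ofCoords_mem h𝓣 hD h₁ hx h₂))
    (sum_mem fun a _ => Submodule.smul_mem _ _ (vectorRank_mem_gmaxeCone φ 𝓣 _))

end FourElements

/-! ### Transfer to an arbitrary four-element base set -/

theorem mainTheorem10 {M N : Type*} [Fintype M] [DecidableEq M] [Fintype N] [DecidableEq N]
    (hN : Fintype.card N = 4) (φ : M → N) (hφ : Function.Surjective φ)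
    (𝓣 : Set (Finset M)) (h𝓣 : ∀ T ∈ 𝓣, IsTransversal φ T)
    (hD : ∀ X Y D : Finset M, IsThreePartition X Y D → Separates X Y 𝓣 → 3 ≤ D.card) :
    (∀ f : Finset N → ℝ, IsPolymatroid f →
      ∃ g : Finset M → ℝ, IsPolymatroid g ∧ HasGMAXE φ 𝓣 f g) ∧
    (∀ c : Finset N → ℝ, IsGMAXEConsequence φ 𝓣 c →
      ∀ f : Finset N → ℝ, IsPolymatroid f → SatisfiesIneq c f) := by
  have key : ∀ f : Finset N → ℝ, IsPolymatroid f →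
      ∃ g : Finset M → ℝ, IsPolymatroid g ∧ HasGMAXE φ 𝓣 f g := by
    intro f hf
    let e : N ≃ Fin 4 := Fintype.equivFinOfCardEq hN
    have hf' : IsPolymatroid fun A : Finset (Fin 4) => f (A.image e.symm) := by
      refine ⟨by simp [hf.empty], fun A B h => hf.mono _ _ (Finset.image_subset_image h),
        fun A B => ?_⟩
      simp only [Finset.image_inter _ _ e.symm.injective, Finset.image_union]
      exact hf.submodular _ _
    obtain ⟨g, hg, hiso, hind⟩ := FourElements.polymatroid_mem_gmaxeCone (φ := e ∘ φ)
      (fun T hT => e.injective.comp_injOn (h𝓣 T hT).injOn) hD hf'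
    refine ⟨g, hg, fun T hT A hA => ?_, hind⟩
    rw [hiso T hT A hA, Finset.image_image]
    congr 2
    ext x
    simp
  exact ⟨key, fun c hc f hf => hc f hf (key f hf)⟩
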